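/- Let $q$ be a prime power and $\mathbb{F}_q$ the field with $q$ elements. A matrix $A\in \mathrm{M}(n,\mathbb{F}_q)$ is alternating if $v^tAv=0$ for all $v\in\mathbb{F}_q^n$; let $\Lambda(n,q)$ be the linear space of alternating $n\times n$ matrices over $\mathbb{F}_q$. An alternating matrix space is a linear subspace $\mathcal{A}\le\Lambda(n,q)$. It is non-degenerate if no non-zero $v\in\mathbb{F}_q^n$ satisfies $Av=0$ for all $A\in\mathcal{A}$. For a subspace $U\le\mathbb{F}_q^n$ of dimension $d$, let $\mathcal{A}|_U=\{T^tAT: A\in\mathcal{A}\}\le\Lambda(d,q)$, where $T$ is an $n\times d$ matrix whose columns form a basis of $U$ (its dimension does not depend on $T$). A direct decomposition of $\mathcal{A}$ is a direct sum decomposition $\mathbb{F}_q^n=U_1\oplus\dots\oplus U_k$ into non-zero subspaces such that $u^tAw=0$ for all $A\in\mathcal{A}$, $u\in U_i$, $w\in U_j$, $i\ne j$, and such that $\dim(\mathcal{A})=\sum_{i=1}^k\dim(\mathcal{A}|_{U_i})$. The space $\mathcal{A}$ is directly indecomposable if it has no direct decomposition with $k\ge 2$ summands. For $n\ge 1$,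 let $\mathrm{NDS}_{n,q}$ be the number of non-degenerate alternating matrix spaces in $\Lambda(n,q)$, and $\mathrm{DIS}_{n,q}$ the number of those that are also directly indecomposable. Let $[n]_q=1+q+\dots+q^{n-1}$, $[n]_q!=[1]_q[2]_q\cdots[n]_q$, and for $f:\mathbb{Z}^+\to\mathbb{N}$ let $$\exp_q(f)=\sum_{n\ge 1} f(n)\,\frac{x^n}{q^{\binom{n}{2}}\,[n]_q!}\in\mathbb{Q}[[x]].$$ Then, as formal power series over $\mathbb{Q}$, $$1+\exp_q(\mathrm{NDS})=e^{\exp_q(\mathrm{DIS})},$$ where $\mathrm{NDS}$ and $\mathrm{DIS}$ denote the functions $n\mapsto\mathrm{NDS}_{n,q}$ and $n\mapsto\mathrm{DIS}_{n,q}$, and $e^{g}=\sum_{c\ge 0}g^c/c!$ for $g\in\mathbb{Q}[[x]]$ with zero constant term. -/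

import Mathlib

namespace AltSpace

open scoped Matrix

/-- The space `Λ(n, F)` of alternating `n × n` matrices: those `A` with `vᵗ A v = 0` for all `v`. -/
def altMatrices (F : Type*) [Field F] (n : ℕ) : Submodule F (Matrix (Fin n) (Fin n) F) where
  carrier := {A | ∀ v : Fin n → F, v ⬝ᵥ A *ᵥ v = 0}
  zero_mem' := by
    intro v
    simp
  add_mem' := by
    intro A B hA hB v
    rw [Matrix.add_mulVec, dotProduct_add, hA v, hB v, add_zero]
  smul_mem' := by
    intro c A hA v
    rw [Matrix.smul_mulVec, dotProduct_smul, hA v, smul_zero]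

/-- The radical `{v | ∀ A ∈ 𝒜, A v = 0}` of a matrix space. -/
def radical {F : Type*} [Field F] {n : ℕ} (𝒜 : Submodule F (Matrix (Fin n) (Fin n) F)) :
    Submodule F (Fin n → F) where
  carrier := {v | ∀ A ∈ 𝒜, A *ᵥ v = 0}
  zero_mem' := by
    intro A _
    exact Matrix.mulVec_zero A
  add_mem' := by
    intro v w hv hw A hA
    rw [Matrix.mulVec_add, hv A hA, hw A hA, add_zero]
  smul_mem' := by
    intro c v hv A hA
    rw [Matrix.mulVec_smul, hv A hA, smul_zero]

/-- A matrix space is non-degenerate if its radical is zero. -/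
def IsNondegenerate {F : Type*} [Field F] {n : ℕ}
    (𝒜 : Submodule F (Matrix (Fin n) (Fin n) F)) : Prop :=
  radical 𝒜 = ⊥

/-- The linear map `A ↦ Tᵗ A T`. -/
def congrMap {F : Type*} [Field F] {n d : ℕ} (T : Matrix (Fin n) (Fin d) F) :
    Matrix (Fin n) (Fin n) F →ₗ[F] Matrix (Fin d) (Fin d) F where
  toFun A := Tᵀ * A * T
  map_add' A B := by rw [Matrix.mul_add, Matrix.add_mul]
  map_smul' c A := by rw [Matrix.mul_smul, Matrix.smul_mul, RingHom.id_apply]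

/-- An `n × dim U` matrix whose columns form a basis of `U`. -/
noncomputable def basisMatrix {F : Type*} [Field F] {n : ℕ} (U : Submodule F (Fin n → F)) :
    Matrix (Fin n) (Fin (Module.finrank F U)) F :=
  Matrix.of fun i j => (Module.finBasis F U j : Fin n → F) i

/-- The restriction of `𝒜` to `U`, namely `{Tᵗ A T | A ∈ 𝒜}` where the columns of `T` form a basis
of `U`. Up to congruence it does not depend on the basis; in particular its dimension does not. -/
noncomputable def restriction {F : Type*} [Field F] {n : ℕ}
    (𝒜 : Submodule F (Matrix (Fin n) (Fin n) F)) (U : Submodule F (Fin n → F)) :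
    Submodule F (Matrix (Fin (Module.finrank F U)) (Fin (Module.finrank F U)) F) :=
  𝒜.map (congrMap (basisMatrix U))

/-- A direct sum decomposition `F^n = U_1 ⊕ ⋯ ⊕ U_k` into non-zero subspaces is an orthogonal
decomposition of `𝒜` if distinct summands are orthogonal under every element of `𝒜`. -/
def IsOrthogonalDecomposition {F : Type*} [Field F] {n k : ℕ}
    (𝒜 : Submodule F (Matrix (Fin n) (Fin n) F)) (U : Fin k → Submodule F (Fin n → F)) : Prop :=
  DirectSum.IsInternal U ∧ (∀ i, U i ≠ ⊥) ∧
    ∀ i j, i ≠ j → ∀ u ∈ U i, ∀ w ∈ U j, ∀ A ∈ 𝒜, u ⬝ᵥ A *ᵥ w = 0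

/-- An orthogonal decomposition is direct if `dim 𝒜` is the sum of the dimensions of the
restrictions of `𝒜` to the summands. -/
def IsDirectDecomposition {F : Type*} [Field F] {n k : ℕ}
    (𝒜 : Submodule F (Matrix (Fin n) (Fin n) F)) (U : Fin k → Submodule F (Fin n → F)) : Prop :=
  IsOrthogonalDecomposition 𝒜 U ∧
    Module.finrank F 𝒜 = ∑ i, Module.finrank F (restriction 𝒜 (U i))

/-- `𝒜` is directly decomposable if it has a direct decomposition with at least two summands. -/
def IsDirectlyDecomposable {F : Type*} [Field F] {n : ℕ}
    (𝒜 : Submodule F (Matrix (Fin n) (Fin n) F)) : Prop :=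
  ∃ k : ℕ, 2 ≤ k ∧ ∃ U : Fin k → Submodule F (Fin n → F), IsDirectDecomposition 𝒜 U

/-- The number of non-degenerate alternating matrix spaces in `Λ(n, F)`. -/
noncomputable def NDS (F : Type*) [Field F] (n : ℕ+) : ℕ :=
  Nat.card {𝒜 : Submodule F (Matrix (Fin n) (Fin n) F) //
    𝒜 ≤ altMatrices F n ∧ IsNondegenerate 𝒜}

/-- The number of directly indecomposable non-degenerate alternating matrix spaces in
`Λ(n, F)`. -/
noncomputable def DIS (F : Type*) [Field F] (n : ℕ+) : ℕ :=
  Nat.card {𝒜 : Submodule F (Matrix (Fin n) (Fin n) F) //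
    𝒜 ≤ altMatrices F n ∧ IsNondegenerate 𝒜 ∧ ¬ IsDirectlyDecomposable 𝒜}

/-- The `q`-integer `[n]_q = 1 + q + ⋯ + q^(n-1)`. -/
def qInt (q n : ℕ) : ℕ := ∑ i ∈ Finset.range n, q ^ i

/-- The `q`-factorial `[n]_q! = [1]_q [2]_q ⋯ [n]_q`. -/
def qFactorial (q n : ℕ) : ℕ := ∏ i ∈ Finset.range n, qInt q (i + 1)

/-- The Eulerian generating function `∑_{n ≥ 1} f(n) xⁿ / (q^(n choose 2) [n]_q!)`, a formal power
series with zero constant term. -/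
noncomputable def expq (q : ℕ) (f : ℕ+ → ℕ) : PowerSeries ℚ :=
  PowerSeries.mk fun n =>
    if h : 0 < n then (f ⟨n, h⟩ : ℚ) / ((q : ℚ) ^ n.choose 2 * (qFactorial q n : ℚ)) else 0

/-- The series `expq q f` may be substituted into any formal power series, so the composition
`PowerSeries.subst` with it is the genuine one. -/
theorem hasSubst_expq (q : ℕ) (f : ℕ+ → ℕ) : PowerSeries.HasSubst (expq q f) := by
  apply PowerSeries.HasSubst.of_constantCoeff_zero'
  rw [← PowerSeries.coeff_zero_eq_constantCoeff_apply, expq, PowerSeries.coeff_mk]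
  simp

end AltSpace

/-!
A direct decomposition of a space `𝒜` of alternating forms on `V` into two summands is the same as
an idempotent `e` of the centroid of `𝒜`: an idempotent endomorphism with `A (e x) y = A x (e y)`
and `A (e ·) · ∈ 𝒜` for all `A ∈ 𝒜` (`IsSplit`). If `𝒜` is non-degenerate, any two such idempotents
commute (`IsSplit.commute`), so they form a finite Boolean algebra. Its atoms (`IsPrimitive`) are
orthogonal with sum `1`; their ranges are the summands of the unique finest direct decomposition of
`𝒜`, and have total dimension `dim V` (`sum_finrank_range_primitive`).

The pairs `(𝒜, e)` with `e` an atom of `𝒜` are now counted in two ways, with weight the rank of `e`.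
For a fixed `𝒜` the weights add up to `n = dim V`. For a fixed idempotent `e` of rank `k`, the space
`𝒜` is the direct sum of an indecomposable space on `range e` and an arbitrary non-degenerate space
on `ker e` (`IsBiprod.card_isPrimitive`). Hence (`finrank_mul_ndsCard`)
`n * NDS n = ∑ k, k * I n k * DIS k * NDS (n - k)`, where
`I n k = |GL_n| / (|GL_k| * |GL_(n-k)|)` is the number of idempotents of rank `k` (`idemCard_mul`).

The order of `GL_n` is `(q - 1) ^ n` times the denominator `q ^ (n choose 2) * [n]_q!` of the
generating functions, and the powers of `q - 1` cancel. So the recurrence is the differential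
equation `y' = g' * y` for `y = 1 + expq NDS` and `g = expq DIS`
(`derivative_one_add_expq_NDS`). Its only solution with constant coefficient `1` is `exp g`.
-/

namespace AltSpace

open Module
open LinearMap (BilinForm)

/-! ### Split idempotents of a space of bilinear forms -/

section Split

variable {F V : Type*} [Field F] [AddCommGroup V] [Module F V]

/-- A non-degenerate space of alternating bilinear forms on `V`. -/
structure IsNDForms (𝒜 : Submodule F (BilinForm F V)) : Prop where
  alt : ∀ A ∈ 𝒜, ∀ v, A v v = 0
  nondeg : ∀ v, (∀ A ∈ 𝒜, ∀ x, A x v = 0) → v = 0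

/-- The idempotents of the centroid of a space `𝒜` of bilinear forms. They encode the direct
decompositions of `𝒜` into two summands: the first two conditions say that `range e` and `ker e`
are complementary and orthogonal under `𝒜`, the third that `𝒜` is the direct sum of its restrictions
to them. -/
structure IsSplit (𝒜 : Submodule F (BilinForm F V)) (e : End F V) : Prop where
  idem : e * e = e
  adj : ∀ A ∈ 𝒜, ∀ x y, A (e x) y = A x (e y)
  mem : ∀ A ∈ 𝒜, A.compLeft e ∈ 𝒜

/-- The minimal non-zero split idempotents: their ranges are the summands of the finest direct
decomposition. -/
structure IsPrimitive (𝒜 : Submodule F (BilinForm F V)) (e : End F V) : Prop where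
  split : IsSplit 𝒜 e
  ne_zero : e ≠ 0
  minimal : ∀ f, IsSplit 𝒜 f → f * e = f → f = 0 ∨ f = e

variable {𝒜 : Submodule F (BilinForm F V)} {e f : End F V}

/-- Moving `e` and `f` across a form of `𝒜` in either order gives the same result, because
`A (f ·) ·` is again a form of `𝒜`; non-degeneracy turns this into an equality of operators. -/
theorem IsSplit.commute (h𝒜 : IsNDForms 𝒜) (he : IsSplit 𝒜 e) (hf : IsSplit 𝒜 f) :
    e * f = f * e := by
  rw [← sub_eq_zero]
  ext y
  refine h𝒜.nondeg _ fun A hA x => ?_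
  have h1 := he.adj _ (hf.mem A hA) x y
  simp only [BilinForm.compLeft_apply] at h1
  simp only [LinearMap.sub_apply, End.mul_apply, map_sub]
  rw [← hf.adj A hA x (e y), ← h1, hf.adj A hA, he.adj A hA, sub_self]

theorem IsSplit.one : IsSplit 𝒜 1 :=
  ⟨by simp, by simp, fun A hA => by
    have : A.compLeft 1 = A := by ext; simp
    rwa [this]⟩

theorem IsSplit.mul (h𝒜 : IsNDForms 𝒜) (he : IsSplit 𝒜 e) (hf : IsSplit 𝒜 f) :
    IsSplit 𝒜 (e * f) where
  idem := by
    have h := he.commute h𝒜 hf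
    calc e * f * (e * f) = e * (f * e) * f := by simp only [mul_assoc]
      _ = (e * e) * (f * f) := by rw [← h]; simp only [mul_assoc]
      _ = e * f := by rw [he.idem, hf.idem]
  adj A hA x y := by
    rw [he.commute h𝒜 hf]
    simp only [End.mul_apply]
    rw [hf.adj A hA, he.adj A hA, ← End.mul_apply e f, he.commute h𝒜 hf, End.mul_apply]
  mem A hA := hf.mem _ (he.mem A hA)

theorem IsSplit.compl (he : IsSplit 𝒜 e) : IsSplit 𝒜 (1 - e) where
  idem := by simp [mul_sub, sub_mul, he.idem]
  adj A hA x y := by simp [he.adj A hA x y]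
  mem A hA := by
    have : A.compLeft (1 - e) = A + (-1 : F) • A.compLeft e := by
      ext; simp [sub_eq_add_neg]
    rw [this]
    exact 𝒜.add_mem hA (𝒜.smul_mem _ (he.mem A hA))

theorem IsPrimitive.mul_eq_zero (h𝒜 : IsNDForms 𝒜) (he : IsPrimitive 𝒜 e)
    (hf : IsPrimitive 𝒜 f) (hne : e ≠ f) : e * f = 0 := by
  have hc := he.split.commute h𝒜 hf.split
  have hm := he.split.mul h𝒜 hf.split
  rcases hf.minimal _ hm (by rw [mul_assoc, hf.split.idem]) with h | h
  · exact h
  · rcases he.minimal _ hm (by rw [hc, mul_assoc, he.split.idem]) with h' | h'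
    · exact h'
    · exact absurd (h'.symm.trans h) hne

/-- Below every non-zero split idempotent there is a primitive one, namely one of least rank. -/
theorem IsSplit.exists_primitive_le [FiniteDimensional F V] (h𝒜 : IsNDForms 𝒜)
    (he : IsSplit 𝒜 e) (h0 : e ≠ 0) :
    ∃ f, IsPrimitive 𝒜 f ∧ f * e = f := by
  induction hn : finrank F (LinearMap.range e) using Nat.strong_induction_on generalizing e with
  | _ n ih =>
    by_cases hp : IsPrimitive 𝒜 e
    · exact ⟨e, hp, he.idem⟩
    · obtain ⟨f, hf, hfe, hf0, hne⟩ : ∃ f, IsSplit 𝒜 f ∧ f * e = f ∧ f ≠ 0 ∧ f ≠ e := by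
        by_contra! h
        exact hp ⟨he, h0, fun f hf hfe => or_iff_not_imp_left.2 (h f hf hfe)⟩
      have hef : e * f = f := by rw [he.commute h𝒜 hf, hfe]
      have hlt : finrank F (LinearMap.range f) < n := by
        rw [← hn]
        refine Submodule.finrank_lt_finrank_of_lt (lt_of_le_of_ne ?_ fun heq => hne ?_)
        · rintro _ ⟨x, rfl⟩
          exact ⟨f x, by rw [← End.mul_apply, hef]⟩
        · rw [← hfe]
          ext x
          obtain ⟨y, hy⟩ : e x ∈ LinearMap.range f := heq ▸ LinearMap.mem_range_self e x
          rw [End.mul_apply, ← hy, ← End.mul_apply, hf.idem]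
      obtain ⟨g, hg, hgf⟩ := ih _ hlt hf hf0 rfl
      exact ⟨g, hg, by rw [← hgf, mul_assoc, hfe]⟩

/-- Complete orthogonal idempotents split the dimension of the space. -/
theorem sum_finrank_range_of_orthogonal [FiniteDimensional F V] (S : Finset (End F V))
    (horth : ∀ e ∈ S, ∀ f ∈ S, e ≠ f → e * f = 0) (hidem : ∀ e ∈ S, e * e = e)
    (hsum : ∑ e ∈ S, e = 1) :
    ∑ e ∈ S, finrank F (LinearMap.range e) = finrank F V := by
  classical
  let φ : V →ₗ[F] (∀ e : S, LinearMap.range (e : End F V)) :=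
    LinearMap.pi fun e => (e : End F V).rangeRestrict
  have hφ : Function.Bijective φ := by
    constructor
    · rw [injective_iff_map_eq_zero]
      intro x hx
      have h : (∑ e ∈ S, e) x = 0 := by
        rw [LinearMap.sum_apply]
        exact Finset.sum_eq_zero fun e he => congrArg Subtype.val (congrFun hx ⟨e, he⟩)
      simpa [hsum] using h
    · intro y
      choose z hz using fun e : S => (y e).2
      refine ⟨∑ e : S, (e : End F V) (z e), ?_⟩
      funext f
      apply Subtype.ext
      change (f : End F V) (∑ e : S, (e : End F V) (z e)) = y f
      rw [map_sum, Finset.sum_eq_single f]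
      · rw [← End.mul_apply, hidem _ f.2, hz]
      · intro e _ hef
        rw [← End.mul_apply, horth _ f.2 _ e.2 (fun h => hef (Subtype.ext h).symm),
          LinearMap.zero_apply]
      · simp
  rw [(LinearEquiv.ofBijective φ hφ).finrank_eq, finrank_pi_fintype,
    Finset.sum_coe_sort S fun e => finrank F (LinearMap.range e)]

/-- The ranges of the primitive split idempotents fill the space: their sum is a split idempotent,
and no primitive one lies below its complement. -/
theorem sum_finrank_range_primitive [FiniteDimensional F V] (h𝒜 : IsNDForms 𝒜)
    (S : Finset (End F V)) (hS : ∀ e, e ∈ S ↔ IsPrimitive 𝒜 e) :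
    ∑ e ∈ S, finrank F (LinearMap.range e) = finrank F V := by
  have horth : ∀ e ∈ S, ∀ f ∈ S, e ≠ f → e * f = 0 := fun e he f hf =>
    ((hS e).1 he).mul_eq_zero h𝒜 ((hS f).1 hf)
  have hidem : ∀ e ∈ S, e * e = e := fun e he => ((hS e).1 he).split.idem
  refine sum_finrank_range_of_orthogonal S horth hidem ?_
  have hmul : ∀ f ∈ S, f * ∑ e ∈ S, e = f := by
    intro f hf
    rw [Finset.mul_sum, Finset.sum_eq_single_of_mem f hf
      fun e he hef => horth f hf e he hef.symm, hidem f hf]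
  have hsplit : IsSplit 𝒜 (∑ e ∈ S, e) := by
    refine ⟨?_, fun A hA x y => ?_, fun A hA => ?_⟩
    · rw [Finset.sum_mul]
      exact Finset.sum_congr rfl hmul
    · simp only [LinearMap.sum_apply, map_sum]
      exact Finset.sum_congr rfl fun e he => ((hS e).1 he).split.adj A hA x y
    · have : A.compLeft (∑ e ∈ S, e) = ∑ e ∈ S, A.compLeft e := by
        ext x y
        simp [LinearMap.sum_apply]
      rw [this]
      exact 𝒜.sum_mem fun e he => ((hS e).1 he).split.mem A hA
  by_contra hne
  obtain ⟨f, hf, hfs⟩ := hsplit.compl.exists_primitive_le h𝒜 (sub_ne_zero.2 (Ne.symm hne))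
  rw [mul_sub, mul_one, hmul f ((hS f).2 hf), sub_self] at hfs
  exact hf.ne_zero hfs.symm

end Split
/-! ### Gluing spaces of forms along a direct sum -/

section Glue

variable {F U V W : Type*} [Field F] [AddCommGroup U] [Module F U] [AddCommGroup V] [Module F V]
  [AddCommGroup W] [Module F W]

/-- Pulling bilinear forms back along a linear map, `B ↦ B (l ·) (l ·)`. -/
def pull (l : U →ₗ[F] V) : BilinForm F V →ₗ[F] BilinForm F U where
  toFun B := B.comp l l
  map_add' _ _ := rfl
  map_smul' _ _ := rfl

@[simp]
theorem pull_apply (l : U →ₗ[F] V) (B : BilinForm F V) (x y : U) :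
    pull l B x y = B (l x) (l y) := rfl

/-- The linear maps `i₁`, `p₁`, `i₂`, `p₂` exhibit `V` as the direct sum of `U` and `W`. -/
structure IsBiprod (i₁ : U →ₗ[F] V) (p₁ : V →ₗ[F] U) (i₂ : W →ₗ[F] V) (p₂ : V →ₗ[F] W) :
    Prop where
  p₁_i₁ : ∀ u, p₁ (i₁ u) = u
  p₂_i₂ : ∀ w, p₂ (i₂ w) = w
  p₁_i₂ : ∀ w, p₁ (i₂ w) = 0
  p₂_i₁ : ∀ u, p₂ (i₁ u) = 0
  total : ∀ v, i₁ (p₁ v) + i₂ (p₂ v) = v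

/-- The space `ℬ ⊕ 𝒞` of block diagonal forms on a direct sum, where `p₁` and `p₂` are the
projections to the summands. -/
def glue (p₁ : V →ₗ[F] U) (p₂ : V →ₗ[F] W) (ℬ : Submodule F (BilinForm F U))
    (𝒞 : Submodule F (BilinForm F W)) : Submodule F (BilinForm F V) :=
  ℬ.map (pull p₁) ⊔ 𝒞.map (pull p₂)

variable {i₁ : U →ₗ[F] V} {p₁ : V →ₗ[F] U} {i₂ : W →ₗ[F] V} {p₂ : V →ₗ[F] W}
  {𝒜 : Submodule F (BilinForm F V)} {ℬ : Submodule F (BilinForm F U)}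
  {𝒞 : Submodule F (BilinForm F W)}

theorem mem_glue {A : BilinForm F V} :
    A ∈ glue p₁ p₂ ℬ 𝒞 ↔ ∃ B ∈ ℬ, ∃ C ∈ 𝒞, pull p₁ B + pull p₂ C = A := by
  simp [glue, Submodule.mem_sup]

theorem glue_comm : glue p₂ p₁ 𝒞 ℬ = glue p₁ p₂ ℬ 𝒞 := sup_comm _ _

namespace IsBiprod

theorem symm (h : IsBiprod i₁ p₁ i₂ p₂) : IsBiprod i₂ p₂ i₁ p₁ :=
  ⟨h.p₂_i₂, h.p₁_i₁, h.p₂_i₁, h.p₁_i₂, fun v => by rw [add_comm, h.total]⟩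

theorem one_sub (h : IsBiprod i₁ p₁ i₂ p₂) : (1 : End F V) - i₁ ∘ₗ p₁ = i₂ ∘ₗ p₂ := by
  ext v
  rw [LinearMap.sub_apply, sub_eq_iff_eq_add]
  simpa [add_comm] using (h.total v).symm

theorem pull_i₁_pull_p₁ (h : IsBiprod i₁ p₁ i₂ p₂) (B : BilinForm F U) :
    pull i₁ (pull p₁ B) = B := by
  ext x y
  simp [h.p₁_i₁]

theorem pull_i₁_pull_p₂ (h : IsBiprod i₁ p₁ i₂ p₂) (C : BilinForm F W) :
    pull i₁ (pull p₂ C) = 0 := by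
  ext x y
  simp [h.p₂_i₁]

theorem map_i₁_glue (h : IsBiprod i₁ p₁ i₂ p₂) : (glue p₁ p₂ ℬ 𝒞).map (pull i₁) = ℬ := by
  ext B
  simp only [Submodule.mem_map, mem_glue]
  constructor
  · rintro ⟨_, ⟨B, hB, C, -, rfl⟩, rfl⟩
    rwa [map_add, h.pull_i₁_pull_p₁, h.pull_i₁_pull_p₂, add_zero]
  · intro hB
    exact ⟨_, ⟨B, hB, 0, 𝒞.zero_mem, rfl⟩, by rw [map_add, h.pull_i₁_pull_p₁, map_zero, map_zero,
      add_zero]⟩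

theorem isSplit_glue (h : IsBiprod i₁ p₁ i₂ p₂) : IsSplit (glue p₁ p₂ ℬ 𝒞) (i₁ ∘ₗ p₁) where
  idem := by
    ext v
    simp [h.p₁_i₁]
  adj := by
    intro A hA x y
    obtain ⟨B, hB, C, hC, rfl⟩ := mem_glue.1 hA
    simp [h.p₁_i₁, h.p₂_i₁]
  mem := by
    intro A hA
    obtain ⟨B, hB, C, hC, rfl⟩ := mem_glue.1 hA
    refine mem_glue.2 ⟨B, hB, 0, 𝒞.zero_mem, ?_⟩
    ext x y
    simp [h.p₁_i₁, h.p₂_i₁]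

theorem isNDForms_glue (h : IsBiprod i₁ p₁ i₂ p₂) (hℬ : IsNDForms ℬ) (h𝒞 : IsNDForms 𝒞) :
    IsNDForms (glue p₁ p₂ ℬ 𝒞) where
  alt := by
    intro A hA v
    obtain ⟨B, hB, C, hC, rfl⟩ := mem_glue.1 hA
    simp [hℬ.alt B hB, h𝒞.alt C hC]
  nondeg := by
    intro v hv
    have h1 : p₁ v = 0 := hℬ.nondeg _ fun B hB u => by
      have := hv _ (mem_glue.2 ⟨B, hB, 0, 𝒞.zero_mem, rfl⟩) (i₁ u)
      simpa [h.p₁_i₁] using this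
    have h2 : p₂ v = 0 := h𝒞.nondeg _ fun C hC w => by
      have := hv _ (mem_glue.2 ⟨0, ℬ.zero_mem, C, hC, rfl⟩) (i₂ w)
      simpa [h.p₂_i₂] using this
    rw [← h.total v, h1, h2, map_zero, map_zero, add_zero]

theorem orthogonal (h : IsBiprod i₁ p₁ i₂ p₂) (he : IsSplit 𝒜 (i₁ ∘ₗ p₁)) {A : BilinForm F V}
    (hA : A ∈ 𝒜) (w : W) (u : U) : A (i₂ w) (i₁ u) = 0 := by
  have := he.adj A hA (i₂ w) (i₁ u)
  simpa [h.p₁_i₁, h.p₁_i₂] using this.symm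

theorem isSplit_symm (h : IsBiprod i₁ p₁ i₂ p₂) (he : IsSplit 𝒜 (i₁ ∘ₗ p₁)) :
    IsSplit 𝒜 (i₂ ∘ₗ p₂) :=
  h.one_sub ▸ he.compl

theorem pull_p₁_pull_i₁ (h : IsBiprod i₁ p₁ i₂ p₂) (he : IsSplit 𝒜 (i₁ ∘ₗ p₁))
    {A : BilinForm F V} (hA : A ∈ 𝒜) : pull p₁ (pull i₁ A) = A.compLeft (i₁ ∘ₗ p₁) := by
  ext x y
  have := he.adj A hA (i₁ (p₁ x)) y
  simpa [h.p₁_i₁] using this.symm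

theorem glue_map (h : IsBiprod i₁ p₁ i₂ p₂) (he : IsSplit 𝒜 (i₁ ∘ₗ p₁)) :
    glue p₁ p₂ (𝒜.map (pull i₁)) (𝒜.map (pull i₂)) = 𝒜 := by
  have he' := h.isSplit_symm he
  ext A
  rw [mem_glue]
  constructor
  · rintro ⟨_, ⟨B, hB, rfl⟩, _, ⟨C, hC, rfl⟩, rfl⟩
    rw [h.pull_p₁_pull_i₁ he hB, h.symm.pull_p₁_pull_i₁ he' hC]
    exact 𝒜.add_mem (he.mem B hB) (he'.mem C hC)
  · intro hA
    refine ⟨_, ⟨A, hA, rfl⟩, _, ⟨A, hA, rfl⟩, ?_⟩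
    rw [h.pull_p₁_pull_i₁ he hA, h.symm.pull_p₁_pull_i₁ he' hA]
    ext x y
    simp [← LinearMap.add_apply, ← map_add, h.total]

theorem isNDForms_map (h : IsBiprod i₁ p₁ i₂ p₂) (h𝒜 : IsNDForms 𝒜)
    (he : IsSplit 𝒜 (i₁ ∘ₗ p₁)) : IsNDForms (𝒜.map (pull i₁)) where
  alt := by
    rintro _ ⟨A, hA, rfl⟩ u
    exact h𝒜.alt A hA _
  nondeg := by
    intro u hu
    have : i₁ u = 0 := h𝒜.nondeg _ fun A hA v => by
      have := hu _ ⟨A, hA, rfl⟩ (p₁ v)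
      rw [pull_apply] at this
      rw [← h.total v, map_add, LinearMap.add_apply, this, h.orthogonal he hA, add_zero]
    rw [← h.p₁_i₁ u, this, map_zero]

/-- The split idempotents below `i₁ p₁` are those of the restriction to the first summand. -/
theorem isPrimitive_iff (h : IsBiprod i₁ p₁ i₂ p₂) (h𝒜 : IsNDForms 𝒜)
    (he : IsSplit 𝒜 (i₁ ∘ₗ p₁)) :
    IsPrimitive 𝒜 (i₁ ∘ₗ p₁) ↔ IsPrimitive (𝒜.map (pull i₁)) 1 := by
  constructor
  · intro hp
    refine ⟨IsSplit.one, fun h0 => hp.ne_zero ?_, fun f hf _ => ?_⟩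
    · ext v
      have : p₁ v = 0 := by simpa using LinearMap.congr_fun h0 (p₁ v)
      simp [this]
    · have hff : ∀ u, f (f u) = f u := fun u => LinearMap.congr_fun hf.idem u
      have hg : IsSplit 𝒜 (i₁ ∘ₗ f ∘ₗ p₁) := by
        refine ⟨?_, fun A hA x y => ?_, fun A hA => ?_⟩
        · ext v
          simp [h.p₁_i₁, hff]
        · have h1 := hf.adj _ ⟨A, hA, rfl⟩ (p₁ x) (p₁ y)
          have h2 := he.adj A hA (i₁ (f (p₁ x))) y
          have h3 := he.adj A hA x (i₁ (f (p₁ y)))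
          simp only [pull_apply, LinearMap.comp_apply, h.p₁_i₁] at h1 h2 h3 ⊢
          rw [h2, h1, h3]
        · obtain ⟨A', hA', hAA'⟩ := hf.mem _ ⟨A, hA, rfl⟩
          have : A.compLeft (i₁ ∘ₗ f ∘ₗ p₁) = A'.compLeft (i₁ ∘ₗ p₁) := by
            rw [← h.pull_p₁_pull_i₁ he hA', hAA']
            ext x y
            have h2 := he.adj A hA (i₁ (f (p₁ x))) y
            simpa [h.p₁_i₁] using h2
          rw [this]
          exact he.mem A' hA'
      rcases hp.minimal _ hg (by ext v; simp [h.p₁_i₁]) with h' | h'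
      · left
        ext u
        have := congrArg p₁ (LinearMap.congr_fun h' (i₁ u))
        simpa [h.p₁_i₁] using this
      · right
        ext u
        have := congrArg p₁ (LinearMap.congr_fun h' (i₁ u))
        simpa [h.p₁_i₁] using this
  · intro hp
    refine ⟨he, fun h0 => hp.ne_zero ?_, fun g hg hge => ?_⟩
    · ext u
      have := congrArg p₁ (LinearMap.congr_fun h0 (i₁ u))
      simpa [h.p₁_i₁] using this
    · have heg : ∀ v, i₁ (p₁ (g v)) = g v := fun v => by
        have : (i₁ ∘ₗ p₁) * g = g := by rw [he.commute h𝒜 hg, hge]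
        exact LinearMap.congr_fun this v
      have hge' : ∀ v, g (i₁ (p₁ v)) = g v := fun v => LinearMap.congr_fun hge v
      have hgg : ∀ v, g (g v) = g v := fun v => LinearMap.congr_fun hg.idem v
      have hf : IsSplit (𝒜.map (pull i₁)) (p₁ ∘ₗ g ∘ₗ i₁) := by
        refine ⟨?_, ?_, ?_⟩
        · ext u
          simp [heg, hgg]
        · rintro _ ⟨A, hA, rfl⟩ x y
          simp [heg, hg.adj A hA]
        · rintro _ ⟨A, hA, rfl⟩
          refine ⟨_, hg.mem A hA, ?_⟩
          ext x y
          simp [heg]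
      rcases hp.minimal _ hf (mul_one _) with h' | h'
      · left
        ext v
        have := congrArg i₁ (LinearMap.congr_fun h' (p₁ v))
        simpa [heg, hge'] using this
      · right
        ext v
        have := congrArg i₁ (LinearMap.congr_fun h' (p₁ v))
        simpa [heg, hge'] using this

end IsBiprod

variable (F V) in
/-- The number of non-degenerate alternating spaces of bilinear forms on `V`. -/
noncomputable def ndsCard : ℕ :=
  Nat.card {𝒜 : Submodule F (BilinForm F V) // IsNDForms 𝒜}

variable (F V) in
/-- The number of directly indecomposable non-degenerate alternating spaces of bilinear forms
on `V`; the space `V = 0` is not indecomposable. -/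
noncomputable def disCard : ℕ :=
  Nat.card {𝒜 : Submodule F (BilinForm F V) // IsNDForms 𝒜 ∧ IsPrimitive 𝒜 1}

/-- A space with a prescribed primitive summand is the direct sum of an indecomposable space on
that summand and an arbitrary non-degenerate space on the complement. -/
theorem IsBiprod.card_isPrimitive (h : IsBiprod i₁ p₁ i₂ p₂) :
    Nat.card {𝒜 : Submodule F (BilinForm F V) // IsNDForms 𝒜 ∧ IsPrimitive 𝒜 (i₁ ∘ₗ p₁)} =
      disCard F U * ndsCard F W := by
  rw [disCard, ndsCard, ← Nat.card_prod]
  exact Nat.card_congr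
    { toFun := fun 𝒜 =>
        (⟨𝒜.1.map (pull i₁), h.isNDForms_map 𝒜.2.1 𝒜.2.2.split,
            (h.isPrimitive_iff 𝒜.2.1 𝒜.2.2.split).1 𝒜.2.2⟩,
          ⟨𝒜.1.map (pull i₂), h.symm.isNDForms_map 𝒜.2.1 (h.isSplit_symm 𝒜.2.2.split)⟩)
      invFun := fun x =>
        ⟨glue p₁ p₂ x.1.1 x.2.1, h.isNDForms_glue x.1.2.1 x.2.2,
          (h.isPrimitive_iff (h.isNDForms_glue x.1.2.1 x.2.2) h.isSplit_glue).2
            (h.map_i₁_glue.symm ▸ x.1.2.2)⟩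
      left_inv := fun 𝒜 => Subtype.ext (h.glue_map 𝒜.2.2.split)
      right_inv := fun x => Prod.ext (Subtype.ext h.map_i₁_glue)
        (Subtype.ext (by
          change (glue p₁ p₂ x.1.1 x.2.1).map (pull i₂) = x.2.1
          rw [← glue_comm, h.symm.map_i₁_glue])) }

end Glue
/-! ### Counting idempotents -/

section Counting

variable {F V : Type*} [Field F] [AddCommGroup V] [Module F V]

theorem isBiprod_of_equiv {U W : Type*} [AddCommGroup U] [Module F U] [AddCommGroup W] [Module F W]
    (P : (U × W) ≃ₗ[F] V) :
    IsBiprod (P.toLinearMap ∘ₗ LinearMap.inl F U W) (LinearMap.fst F U W ∘ₗ P.symm.toLinearMap)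
      (P.toLinearMap ∘ₗ LinearMap.inr F U W) (LinearMap.snd F U W ∘ₗ P.symm.toLinearMap) where
  p₁_i₁ u := by simp
  p₂_i₂ w := by simp
  p₁_i₂ w := by simp
  p₂_i₁ u := by simp
  total v := by simp [← map_add]

/-- The projection of `V` to its first summand, for an identification of `V` with a product. -/
def projOfEquiv {U W : Type*} [AddCommGroup U] [Module F U] [AddCommGroup W] [Module F W]
    (P : (U × W) ≃ₗ[F] V) : End F V :=
  (P.toLinearMap ∘ₗ LinearMap.inl F U W) ∘ₗ (LinearMap.fst F U W ∘ₗ P.symm.toLinearMap)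

theorem projOfEquiv_apply {U W : Type*} [AddCommGroup U] [Module F U] [AddCommGroup W]
    [Module F W] (P : (U × W) ≃ₗ[F] V) (v : V) : projOfEquiv P v = P ((P.symm v).1, 0) := rfl

theorem projOfEquiv_idem {U W : Type*} [AddCommGroup U] [Module F U] [AddCommGroup W] [Module F W]
    (P : (U × W) ≃ₗ[F] V) : projOfEquiv P * projOfEquiv P = projOfEquiv P := by
  ext v
  simp [projOfEquiv_apply]

theorem range_projOfEquiv {U W : Type*} [AddCommGroup U] [Module F U] [AddCommGroup W]
    [Module F W] (P : (U × W) ≃ₗ[F] V) :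
    LinearMap.range (projOfEquiv P) = LinearMap.range (P.toLinearMap ∘ₗ LinearMap.inl F U W) := by
  ext v
  constructor
  · rintro ⟨x, rfl⟩
    exact ⟨(P.symm x).1, rfl⟩
  · rintro ⟨u, rfl⟩
    exact ⟨P (u, 0), by simp [projOfEquiv_apply]⟩

theorem ker_projOfEquiv {U W : Type*} [AddCommGroup U] [Module F U] [AddCommGroup W]
    [Module F W] (P : (U × W) ≃ₗ[F] V) :
    LinearMap.ker (projOfEquiv P) = LinearMap.range (P.toLinearMap ∘ₗ LinearMap.inr F U W) := by
  ext v
  rw [LinearMap.mem_ker, projOfEquiv_apply]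
  constructor
  · intro hv
    have h1 : (P.symm v).1 = 0 := by simpa using hv
    exact ⟨(P.symm v).2, by
      rw [LinearMap.comp_apply, LinearMap.inr_apply, ← h1]
      exact P.apply_symm_apply v⟩
  · rintro ⟨w, rfl⟩
    simp

theorem injective_comp_inl {U W : Type*} [AddCommGroup U] [Module F U] [AddCommGroup W]
    [Module F W] (P : (U × W) ≃ₗ[F] V) :
    Function.Injective (P.toLinearMap ∘ₗ LinearMap.inl F U W) :=
  P.injective.comp LinearMap.inl_injective

theorem injective_comp_inr {U W : Type*} [AddCommGroup U] [Module F U] [AddCommGroup W]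
    [Module F W] (P : (U × W) ≃ₗ[F] V) :
    Function.Injective (P.toLinearMap ∘ₗ LinearMap.inr F U W) :=
  P.injective.comp LinearMap.inr_injective

/-- Identifying `U` with the range of an idempotent `e` and `W` with its kernel turns `e` into the
first projection. -/
theorem projOfEquiv_prodCongr {U W : Type*} [AddCommGroup U] [Module F U] [AddCommGroup W]
    [Module F W] {e : End F V} (he : e * e = e)
    (hc : IsCompl (LinearMap.range e) (LinearMap.ker e)) (α : U ≃ₗ[F] LinearMap.range e)
    (β : W ≃ₗ[F] LinearMap.ker e) :
    projOfEquiv ((α.prodCongr β).trans (Submodule.prodEquivOfIsCompl _ _ hc)) = e := by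
  have hfix : ∀ y : LinearMap.range e, e y = y := by
    rintro ⟨_, z, rfl⟩
    exact LinearMap.congr_fun he z
  ext v
  obtain ⟨⟨u, w⟩, rfl⟩ := ((α.prodCongr β).trans (Submodule.prodEquivOfIsCompl _ _ hc)).surjective v
  rw [projOfEquiv_apply, LinearEquiv.symm_apply_apply]
  simp [hfix]

/-- Identifying `V` with `U × W` so that `e` becomes the first projection amounts to identifying
`U` with the range of `e` and `W` with its kernel. -/
theorem card_projOfEquiv_eq {U W : Type*} [AddCommGroup U] [Module F U] [AddCommGroup W]
    [Module F W] {e : End F V} (he : e * e = e) :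
    Nat.card {P : (U × W) ≃ₗ[F] V // projOfEquiv P = e} =
      Nat.card (U ≃ₗ[F] LinearMap.range e) * Nat.card (W ≃ₗ[F] LinearMap.ker e) := by
  have hc : IsCompl (LinearMap.range e) (LinearMap.ker e) :=
    LinearMap.IsIdempotentElem.isCompl he
  rw [← Nat.card_prod]
  symm
  let φ (x : (U ≃ₗ[F] LinearMap.range e) × (W ≃ₗ[F] LinearMap.ker e)) : (U × W) ≃ₗ[F] V :=
    (x.1.prodCongr x.2).trans (Submodule.prodEquivOfIsCompl _ _ hc)
  have hφ (x) (u : U) (w : W) : φ x (u, w) = (x.1 u : V) + x.2 w := rfl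
  have hφe (x) : projOfEquiv (φ x) = e := projOfEquiv_prodCongr he hc x.1 x.2
  refine Nat.card_congr (Equiv.ofBijective (fun x => ⟨φ x, hφe x⟩) ⟨fun x y hxy => ?_, ?_⟩)
  · have h : ∀ u w, φ x (u, w) = φ y (u, w) := fun u w => by
      rw [show φ x = φ y from congrArg Subtype.val hxy]
    refine Prod.ext (LinearEquiv.ext fun u => Subtype.ext ?_)
      (LinearEquiv.ext fun w => Subtype.ext ?_)
    · simpa [hφ] using h u 0
    · simpa [hφ] using h 0 w
  · rintro ⟨P, rfl⟩
    refine ⟨(LinearEquiv.ofInjective _ (injective_comp_inl P) ≪≫ₗ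
        LinearEquiv.ofEq _ _ (range_projOfEquiv P).symm,
      LinearEquiv.ofInjective _ (injective_comp_inr P) ≪≫ₗ
        LinearEquiv.ofEq _ _ (ker_projOfEquiv P).symm), ?_⟩
    refine Subtype.ext (LinearEquiv.ext fun ⟨u, w⟩ => ?_)
    change P (u, 0) + P (0, w) = P (u, w)
    rw [← map_add, Prod.mk_add_mk, add_zero, zero_add]

variable (F) in
/-- The order of the general linear group of `F ^ n`. -/
noncomputable def glCard (n : ℕ) : ℕ := Nat.card ((Fin n → F) ≃ₗ[F] (Fin n → F))

theorem card_equiv_eq_glCard [FiniteDimensional F V] {n : ℕ} (hn : finrank F V = n) :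
    Nat.card ((Fin n → F) ≃ₗ[F] V) = glCard F n := by
  have P : V ≃ₗ[F] (Fin n → F) := LinearEquiv.ofFinrankEq _ _ (by simp [hn])
  exact Nat.card_congr
    { toFun := fun Q => Q.trans P
      invFun := fun Q => Q.trans P.symm
      left_inv := fun Q => by ext; simp
      right_inv := fun Q => by ext; simp }

theorem finrank_ker_of_idem [FiniteDimensional F V] {e : End F V} {k m : ℕ}
    (hV : finrank F V = k + m) (hk : finrank F (LinearMap.range e) = k) :
    finrank F (LinearMap.ker e) = m := by
  have := e.finrank_range_add_finrank_ker
  omega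

/-- An idempotent of rank `k` comes from an identification of `V` with `F ^ k × F ^ m`. -/
theorem exists_projOfEquiv_eq [FiniteDimensional F V] {e : End F V} (he : e * e = e) {k m : ℕ}
    (hV : finrank F V = k + m) (hk : finrank F (LinearMap.range e) = k) :
    ∃ P : ((Fin k → F) × (Fin m → F)) ≃ₗ[F] V, projOfEquiv P = e := by
  have hc : IsCompl (LinearMap.range e) (LinearMap.ker e) :=
    LinearMap.IsIdempotentElem.isCompl he
  have α : (Fin k → F) ≃ₗ[F] LinearMap.range e := LinearEquiv.ofFinrankEq _ _ (by simp [hk])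
  have β : (Fin m → F) ≃ₗ[F] LinearMap.ker e :=
    LinearEquiv.ofFinrankEq _ _ (by simp [finrank_ker_of_idem hV hk])
  exact ⟨_, projOfEquiv_prodCongr he hc α β⟩

variable (F V) in
/-- The number of idempotent endomorphisms of `V` of rank `k`, that is, of ordered pairs of
complementary subspaces the first of which has dimension `k`. -/
noncomputable def idemCard (k : ℕ) : ℕ :=
  Nat.card {e : End F V // e * e = e ∧ finrank F (LinearMap.range e) = k}

/-- The general linear group acts transitively on the idempotents of rank `k`, with stabilizer
`GL_k × GL_m`. -/
theorem idemCard_mul [Finite F] [Finite V] {k m : ℕ} (hV : finrank F V = k + m) :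
    idemCard F V k * (glCard F k * glCard F m) = glCard F (k + m) := by
  classical
  have hfin : Finite (End F V) := Finite.of_injective _ DFunLike.coe_injective
  let T := {e : End F V // e * e = e ∧ finrank F (LinearMap.range e) = k}
  have : Fintype T := Fintype.ofFinite T
  let E := ((Fin k → F) × (Fin m → F)) ≃ₗ[F] V
  let φ (P : E) : T := ⟨projOfEquiv P, projOfEquiv_idem P, by
    rw [range_projOfEquiv, LinearMap.finrank_range_of_inj (injective_comp_inl P)]
    simp⟩
  have hfib (e : T) : Nat.card {P : E // φ P = e} = glCard F k * glCard F m := by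
    rw [← card_equiv_eq_glCard e.2.2, ← card_equiv_eq_glCard (finrank_ker_of_idem hV e.2.2),
      ← card_projOfEquiv_eq e.2.1]
    exact Nat.card_congr (Equiv.subtypeEquivRight fun P => Subtype.ext_iff)
  have hE : Nat.card E = glCard F (k + m) := by
    rw [← card_equiv_eq_glCard hV]
    have Q : (Fin (k + m) → F) ≃ₗ[F] ((Fin k → F) × (Fin m → F)) :=
      LinearEquiv.ofFinrankEq _ _ (by simp)
    exact Nat.card_congr
      { toFun := fun P => Q.trans P
        invFun := fun P => Q.symm.trans P
        left_inv := fun P => by ext : 1; simp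
        right_inv := fun P => by ext; simp }
  have : Finite E := Finite.of_injective (fun P : E => (P : (Fin k → F) × (Fin m → F) → V))
    DFunLike.coe_injective
  rw [← hE, Nat.card_congr (Equiv.sigmaFiberEquiv φ).symm, Nat.card_sigma]
  simp only [hfib, Finset.sum_const, Finset.card_univ, smul_eq_mul, idemCard,
    Nat.card_eq_fintype_card]
  rfl

/-! ### The recurrence -/

/-- Counting the primitive summands of the non-degenerate spaces on `V`, weighted by dimension:
those of one space have total dimension `dim V`, and a given summand together with its orthogonal
complement leaves `disCard * ndsCard` choices of the space. -/
theorem finrank_mul_ndsCard [Finite F] [Finite V] :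
    finrank F V * ndsCard F V = ∑ k ∈ Finset.range (finrank F V + 1),
      k * (idemCard F V k *
        (disCard F (Fin k → F) * ndsCard F (Fin (finrank F V - k) → F))) := by
  classical
  have : Finite (End F V) := Finite.of_injective _ DFunLike.coe_injective
  have : Finite (BilinForm F V) := Finite.of_injective (fun A : BilinForm F V => fun x y => A x y)
    fun A B h => LinearMap.ext₂ fun x y => congrFun (congrFun h x) y
  have : Finite (Submodule F (BilinForm F V)) := Finite.of_injective _ SetLike.coe_injective
  let N := {𝒜 : Submodule F (BilinForm F V) // IsNDForms 𝒜}
  have : Fintype N := Fintype.ofFinite N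
  have : Fintype (End F V) := Fintype.ofFinite _
  have hrank (e : End F V) : finrank F (LinearMap.range e) ≤ finrank F V :=
    Submodule.finrank_le _
  have h1 : finrank F V * ndsCard F V =
      ∑ 𝒜 : N, ∑ e : End F V, if IsPrimitive 𝒜.1 e then finrank F (LinearMap.range e) else 0 := by
    rw [ndsCard, Nat.card_eq_fintype_card, mul_comm, ← smul_eq_mul, ← Finset.card_univ,
      ← Finset.sum_const]
    refine Finset.sum_congr rfl fun 𝒜 _ => ?_
    rw [← Finset.sum_filter, sum_finrank_range_primitive 𝒜.2 _ (by simp)]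
  have h2 (e : End F V) : (∑ 𝒜 : N, if IsPrimitive 𝒜.1 e then finrank F (LinearMap.range e) else 0)
      = if e * e = e then finrank F (LinearMap.range e) *
          (disCard F (Fin (finrank F (LinearMap.range e)) → F) *
            ndsCard F (Fin (finrank F V - finrank F (LinearMap.range e)) → F)) else 0 := by
    split_ifs with he
    · obtain ⟨P, hP⟩ := exists_projOfEquiv_eq he
        (Nat.add_sub_cancel' (hrank e)).symm rfl
      have h3 := (isBiprod_of_equiv P).card_isPrimitive
      rw [← h3, ← Finset.sum_filter, Finset.sum_const, smul_eq_mul, mul_comm,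
        ← Fintype.card_subtype, ← Nat.card_eq_fintype_card]
      congr 1
      change _ = Nat.card {𝒜 : Submodule F (BilinForm F V) //
        IsNDForms 𝒜 ∧ IsPrimitive 𝒜 (projOfEquiv P)}
      rw [hP]
      exact Nat.card_congr 
        (Equiv.subtypeSubtypeEquivSubtypeInter IsNDForms fun 𝒜 => IsPrimitive 𝒜 e)
    · exact Finset.sum_eq_zero fun 𝒜 _ => if_neg fun h => he h.split.idem
  rw [h1, Finset.sum_comm]
  simp only [h2]
  rw [← Finset.sum_filter, ← Finset.sum_fiberwise_of_maps_to
    (g := fun e : End F V => finrank F (LinearMap.range e)) (t := Finset.range (finrank F V + 1))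
    (fun e _ => Finset.mem_range.2 (Nat.lt_succ_of_le (hrank e)))]
  refine Finset.sum_congr rfl fun k _ => ?_
  rw [Finset.sum_congr rfl (g := fun _ => k * (disCard F (Fin k → F) *
    ndsCard F (Fin (finrank F V - k) → F))) fun e he => by rw [(Finset.mem_filter.1 he).2]]
  rw [Finset.sum_const, Finset.filter_filter, ← Fintype.card_subtype, ← Nat.card_eq_fintype_card,
    smul_eq_mul, idemCard]
  ring

theorem ndsCard_zero : ndsCard F (Fin 0 → F) = 1 := by
  rw [ndsCard, Nat.card_eq_one_iff_unique]
  exact ⟨⟨fun 𝒜 ℬ => Subtype.ext (Subsingleton.elim _ _)⟩,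
    ⟨⊥, ⟨fun A _ v => by rw [Subsingleton.elim v 0, map_zero], fun v _ => Subsingleton.elim _ _⟩⟩⟩

theorem disCard_zero : disCard F (Fin 0 → F) = 0 := by
  rw [disCard, Nat.card_eq_zero]
  exact Or.inl ⟨fun 𝒜 => 𝒜.2.2.ne_zero (Subsingleton.elim _ _)⟩

/-- The order of the general linear group is `(q - 1) ^ n` times the denominator in the Eulerian
generating function. -/
theorem glCard_eq [Fintype F] (n : ℕ) :
    glCard F n = (Fintype.card F) ^ n.choose 2 * qFactorial (Fintype.card F) n *
      (Fintype.card F - 1) ^ n := by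
  have hq : 1 ≤ Fintype.card F := Fintype.card_pos
  set q := Fintype.card F with hqdef
  have h1 : glCard F n = ∏ i ∈ Finset.range n, (q ^ n - q ^ i) := by
    rw [← Fin.prod_univ_eq_prod_range (fun i => q ^ n - q ^ i), hqdef, ← Matrix.card_GL_field]
    exact Nat.card_congr (Matrix.GeneralLinearGroup.toLin.trans
      (LinearMap.GeneralLinearGroup.generalLinearEquiv F (Fin n → F))).symm.toEquiv
  have h2 : ∀ i ∈ Finset.range n, q ^ n - q ^ i = q ^ i * (qInt q (n - 1 - i + 1) * (q - 1)) := by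
    intro i hi
    have hi' := Finset.mem_range.1 hi
    rw [qInt, geom_sum_mul_of_one_le hq, Nat.mul_sub, mul_one, ← pow_add]
    congr 2
    omega
  rw [h1, Finset.prod_congr rfl h2, Finset.prod_mul_distrib, Finset.prod_pow_eq_pow_sum,
    Finset.prod_range_reflect (fun j => qInt q (j + 1) * (q - 1)), Finset.prod_mul_distrib,
    Finset.prod_const, Finset.card_range, Finset.sum_range_id, Nat.choose_two_right, qFactorial,
    mul_assoc]

end Counting
/-! ### From matrices to bilinear forms -/

section Bridge

variable {F : Type*} [Field F] {n : ℕ}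

/-- The space of bilinear forms attached to a space of matrices. -/
noncomputable def toForms (𝒜 : Submodule F (Matrix (Fin n) (Fin n) F)) :
    Submodule F (BilinForm F (Fin n → F)) :=
  𝒜.map (Matrix.toBilin' : Matrix (Fin n) (Fin n) F ≃ₗ[F] _).toLinearMap

theorem isNDForms_toForms_iff (𝒜 : Submodule F (Matrix (Fin n) (Fin n) F)) :
    IsNDForms (toForms 𝒜) ↔ 𝒜 ≤ altMatrices F n ∧ IsNondegenerate 𝒜 := by
  have hv (A : Matrix (Fin n) (Fin n) F) (v : Fin n → F) :
      (∀ x, x ⬝ᵥ A.mulVec v = 0) ↔ A.mulVec v = 0 :=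
    ⟨fun h => dotProduct_eq_zero _ fun x => by rw [dotProduct_comm]; exact h x,
      fun h x => by rw [h, dotProduct_zero]⟩
  have hrad : IsNondegenerate 𝒜 ↔ ∀ v, (∀ A ∈ 𝒜, A.mulVec v = 0) → v = 0 := by
    rw [IsNondegenerate, Submodule.eq_bot_iff]
    rfl
  rw [hrad]
  constructor
  · intro h
    refine ⟨fun A hA v => ?_, fun v h0 => h.nondeg v ?_⟩
    · have := h.alt _ ⟨A, hA, rfl⟩ v
      simpa [Matrix.toBilin'_apply'] using this
    · rintro _ ⟨A, hA, rfl⟩ x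
      simp [Matrix.toBilin'_apply', h0 A hA]
  · rintro ⟨h1, h2⟩
    refine ⟨?_, fun v hv0 => h2 v fun A hA => (hv A v).1 fun x => ?_⟩
    · rintro _ ⟨A, hA, rfl⟩ v
      simpa [Matrix.toBilin'_apply'] using h1 hA v
    · have := hv0 _ ⟨A, hA, rfl⟩ x
      simpa [Matrix.toBilin'_apply'] using this

theorem finrank_restriction (𝒜 : Submodule F (Matrix (Fin n) (Fin n) F))
    (U : Submodule F (Fin n → F)) :
    finrank F (restriction 𝒜 U) = finrank F ((toForms 𝒜).map (pull U.subtype)) := by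
  let b := finBasis F U
  have hT : ∀ c : Fin (finrank F U) → F,
      (basisMatrix U).mulVec c = U.subtype (b.equivFun.symm c) := by
    intro c
    ext i
    simp [Matrix.mulVec, dotProduct, basisMatrix, b, Basis.equivFun_symm_apply, mul_comm]
  have key : (restriction 𝒜 U).map (Matrix.toBilin' :
      Matrix (Fin (finrank F U)) (Fin (finrank F U)) F ≃ₗ[F] _).toLinearMap =
      ((toForms 𝒜).map (pull U.subtype)).map (pull b.equivFun.symm.toLinearMap) := by
    rw [restriction, toForms, ← Submodule.map_comp, ← Submodule.map_comp, ← Submodule.map_comp]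
    congr 1
    refine LinearMap.ext fun A => LinearMap.ext₂ fun x y => ?_
    have h1 : x ⬝ᵥ ((basisMatrix U).transpose * A * basisMatrix U).mulVec y =
        (basisMatrix U).mulVec x ⬝ᵥ A.mulVec ((basisMatrix U).mulVec y) := by
      rw [← Matrix.mulVec_mulVec, ← Matrix.mulVec_mulVec, Matrix.dotProduct_mulVec,
        Matrix.vecMul_transpose]
    simp only [LinearMap.comp_apply, LinearEquiv.coe_coe, Matrix.toBilin'_apply', pull_apply]
    rw [← hT, ← hT, ← h1]
    rfl
  have hinj : Function.Injective (pull b.equivFun.symm.toLinearMap) := by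
    intro B C h
    refine LinearMap.ext₂ fun x y => ?_
    have := LinearMap.congr_fun₂ h (b.equivFun x) (b.equivFun y)
    simpa using this
  rw [(Submodule.equivMapOfInjective _ hinj _).finrank_eq, ← key]
  exact (LinearEquiv.finrank_map_eq _ _).symm

section Decomposition

variable {V : Type*} [AddCommGroup V] [Module F V] {ι : Type*}

/-- The additive group structure on a space of bilinear forms that extends the additive monoid
structure of `Submodule.addCommMonoid`. -/
abbrev formsAddCommGroup (𝒜 : Submodule F (BilinForm F V)) : AddCommGroup 𝒜 :=
  Module.addCommMonoidToAddCommGroup F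

attribute [local instance] formsAddCommGroup

/-- A bilinear form is determined by its values on the summands of a decomposition. -/
theorem ext_of_iSup_eq_top {U : ι → Submodule F V} (hU : iSup U = ⊤) {A B : BilinForm F V}
    (h : ∀ i j, ∀ x ∈ U i, ∀ y ∈ U j, A x y = B x y) : A = B := by
  refine LinearMap.ext₂ fun x y => ?_
  have hx : x ∈ iSup U := hU ▸ Submodule.mem_top
  have hy : y ∈ iSup U := hU ▸ Submodule.mem_top
  induction hx using Submodule.iSup_induction' with
  | mem i x hx =>
    induction hy using Submodule.iSup_induction' with
    | mem j y hy => exact h i j x hx y hy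
    | zero => simp
    | add y z _ _ h1 h2 => rw [map_add, map_add, h1, h2]
  | zero => simp
  | add x z _ _ h1 h2 => rw [map_add, map_add, LinearMap.add_apply, LinearMap.add_apply, h1, h2]

/-- Restricting the forms of a space to each of the summands of a decomposition. -/
def restrictAll (𝒜 : Submodule F (BilinForm F V)) (U : ι → Submodule F V) :
    𝒜 →ₗ[F] ∀ i, 𝒜.map (pull (U i).subtype) :=
  LinearMap.pi fun i =>
    ((pull (U i).subtype).restrict fun _ hA => Submodule.mem_map_of_mem hA)

theorem restrictAll_apply (𝒜 : Submodule F (BilinForm F V)) (U : ι → Submodule F V) (A : 𝒜)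
    (i : ι) : (restrictAll 𝒜 U A i : BilinForm F (U i)) = pull (U i).subtype A := rfl

theorem restrictAll_injective {𝒜 : Submodule F (BilinForm F V)} {U : ι → Submodule F V}
    (hU : iSup U = ⊤)
    (horth : ∀ i j, i ≠ j → ∀ u ∈ U i, ∀ w ∈ U j, ∀ A ∈ 𝒜, A u w = 0) :
    Function.Injective (restrictAll 𝒜 U) := by
  intro A B h
  refine Subtype.ext (ext_of_iSup_eq_top hU fun i j x hx y hy => ?_)
  by_cases hij : i = j
  · subst hij
    have h1 := congrArg Subtype.val (congrFun h i)
    exact LinearMap.congr_fun₂ h1 ⟨x, hx⟩ ⟨y, hy⟩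
  · rw [horth i j hij x hx y hy A A.2, horth i j hij x hx y hy B B.2]

/-- If the dimensions add up, any summand of an orthogonal decomposition is the range of a split
idempotent: by the dimension count the restriction of a form of `𝒜` to a single summand, extended
by zero, lies in `𝒜` again. -/
theorem exists_isSplit_of_finrank_eq [Fintype ι] [DecidableEq ι] [FiniteDimensional F V]
    {𝒜 : Submodule F (BilinForm F V)} {U : ι → Submodule F V} (hU : DirectSum.IsInternal U)
    (horth : ∀ i j, i ≠ j → ∀ u ∈ U i, ∀ w ∈ U j, ∀ A ∈ 𝒜, A u w = 0)
    (hdim : finrank F 𝒜 = ∑ i, finrank F (𝒜.map (pull (U i).subtype))) (k : ι) :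
    ∃ e, IsSplit 𝒜 e ∧ (∀ x ∈ U k, e x = x) ∧ ∀ i ≠ k, ∀ x ∈ U i, e x = 0 := by
  have htop := hU.submodule_iSup_eq_top
  have hc : IsCompl (U k) (⨆ j ≠ k, U j) := by
    refine ⟨hU.submodule_iSupIndep k, codisjoint_iff_le_sup.2 ?_⟩
    rw [← htop]
    refine iSup_le fun i => ?_
    by_cases hik : i = k
    · exact hik ▸ le_sup_left
    · exact (le_iSup₂_of_le (f := fun j (_ : j ≠ k) => U j) i hik le_rfl).trans le_sup_right
  let e : End F V := (U k).projection _ hc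
  have he1 : ∀ x ∈ U k, e x = x := fun x hx => Submodule.projection_apply_of_mem_left hc hx
  have he0 : ∀ i ≠ k, ∀ x ∈ U i, e x = 0 := fun i hi x hx =>
    (Submodule.projection_apply_eq_zero_iff hc).2
      ((le_iSup₂_of_le (f := fun j (_ : j ≠ k) => U j) i hi le_rfl) hx)
  have hsurj : Function.Surjective (restrictAll 𝒜 U) := by
    refine (LinearMap.injective_iff_surjective_of_finrank_eq_finrank
      (f := restrictAll 𝒜 U) ?_).1 (restrictAll_injective htop horth)
    rw [finrank_pi_fintype, hdim]
  refine ⟨e, ⟨Submodule.isIdempotentElem_projection hc, fun A hA => ?_, fun A hA => ?_⟩, he1, he0⟩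
  · have : A.compLeft e = A.compRight e := by
      refine ext_of_iSup_eq_top htop fun i j x hx y hy => ?_
      rw [BilinForm.compLeft_apply, BilinForm.compRight_apply]
      by_cases hi : i = k <;> by_cases hj : j = k
      · subst hi
        subst hj
        rw [he1 x hx, he1 y hy]
      · subst hi
        rw [he1 x hx, he0 j hj y hy, map_zero, horth i j (Ne.symm hj) x hx y hy A hA]
      · subst hj
        rw [he1 y hy, he0 i hi x hx, map_zero, LinearMap.zero_apply,
          horth i j hi x hx y hy A hA]
      · rw [he0 i hi x hx, he0 j hj y hy, map_zero, map_zero, LinearMap.zero_apply]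
    exact fun x y => LinearMap.congr_fun₂ this x y
  · obtain ⟨A', hA'⟩ := hsurj fun i => if i = k then restrictAll 𝒜 U ⟨A, hA⟩ i else 0
    have : A.compLeft e = A' := by
      refine ext_of_iSup_eq_top htop fun i j x hx y hy => ?_
      rw [BilinForm.compLeft_apply]
      by_cases hij : i = j
      · subst hij
        have h0 := congrFun hA' i
        by_cases hi : i = k
        · subst hi
          rw [if_pos rfl] at h0
          rw [he1 x hx]
          exact (LinearMap.congr_fun₂ (congrArg Subtype.val h0) ⟨x, hx⟩ ⟨y, hy⟩).symm
        · rw [if_neg hi] at h0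
          rw [he0 i hi x hx, map_zero]
          exact (LinearMap.congr_fun₂ (congrArg Subtype.val h0) ⟨x, hx⟩ ⟨y, hy⟩).symm
      · rw [horth i j hij x hx y hy A' A'.2]
        by_cases hi : i = k
        · subst hi
          rw [he1 x hx, horth i j hij x hx y hy A hA]
        · rw [he0 i hi x hx, map_zero, LinearMap.zero_apply]
    rw [this]
    exact A'.2

/-- The two summands cut out by a split idempotent. -/
def splitSummands (e : End F V) : Fin 2 → Submodule F V :=
  ![LinearMap.range e, LinearMap.ker e]

theorem isInternal_splitSummands {e : End F V} (he : e * e = e) :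
    DirectSum.IsInternal (splitSummands e) :=
  (DirectSum.isInternal_submodule_iff_isCompl _ (i := 0) (j := 1) (by decide)
    (by ext i; fin_cases i <;> simp)).2 (LinearMap.IsIdempotentElem.isCompl he)

theorem IsSplit.orthogonal {𝒜 : Submodule F (BilinForm F V)} {e : End F V} (he : IsSplit 𝒜 e)
    (i j : Fin 2) (hij : i ≠ j) : ∀ u ∈ splitSummands e i, ∀ w ∈ splitSummands e j, ∀ A ∈ 𝒜,
      A u w = 0 := by
  have h01 : ∀ u ∈ LinearMap.range e, ∀ w ∈ LinearMap.ker e, ∀ A ∈ 𝒜, A u w = 0 := by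
    rintro _ ⟨u, rfl⟩ w hw A hA
    rw [he.adj A hA, LinearMap.mem_ker.1 hw, map_zero]
  have h10 : ∀ u ∈ LinearMap.ker e, ∀ w ∈ LinearMap.range e, ∀ A ∈ 𝒜, A u w = 0 := by
    rintro u hu _ ⟨w, rfl⟩ A hA
    rw [← he.adj A hA, LinearMap.mem_ker.1 hu, map_zero, LinearMap.zero_apply]
  fin_cases i <;> fin_cases j
  · exact absurd rfl hij
  · exact h01
  · exact h10
  · exact absurd rfl hij

theorem IsSplit.finrank_eq [FiniteDimensional F V] {𝒜 : Submodule F (BilinForm F V)} {e : End F V}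
    (he : IsSplit 𝒜 e) :
    finrank F 𝒜 = ∑ i, finrank F (𝒜.map (pull (splitSummands e i).subtype)) := by
  rw [← finrank_pi_fintype]
  refine (LinearEquiv.ofBijective (restrictAll 𝒜 (splitSummands e))
    ⟨restrictAll_injective (isInternal_splitSummands he.idem).submodule_iSup_eq_top
      he.orthogonal, fun B => ?_⟩).finrank_eq
  obtain ⟨A₀, hA₀, h₀⟩ := (B 0).2
  obtain ⟨A₁, hA₁, h₁⟩ := (B 1).2
  have hfix : ∀ x ∈ LinearMap.range e, e x = x := by
    rintro _ ⟨z, rfl⟩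
    exact LinearMap.congr_fun he.idem z
  refine ⟨⟨A₀.compLeft e + A₁.compLeft (1 - e),
    𝒜.add_mem (he.mem _ hA₀) (he.compl.mem _ hA₁)⟩, funext fun i => Subtype.ext ?_⟩
  rw [restrictAll_apply]
  fin_cases i
  · refine Eq.trans (LinearMap.ext₂ fun x y => ?_) h₀
    simp [hfix x x.2]
  · refine Eq.trans (LinearMap.ext₂ fun x y => ?_) h₁
    have hx : e x = 0 := x.2
    simp [hx]

end Decomposition

theorem isDirectlyDecomposable_iff (𝒜 : Submodule F (Matrix (Fin n) (Fin n) F)) :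
    IsDirectlyDecomposable 𝒜 ↔ ∃ e, IsSplit (toForms 𝒜) e ∧ e ≠ 0 ∧ e ≠ 1 := by
  have hfr : finrank F (toForms 𝒜) = finrank F 𝒜 := LinearEquiv.finrank_map_eq _ _
  constructor
  · rintro ⟨k, hk, U, ⟨hU, hne, horth⟩, hdim⟩
    have horth' : ∀ i j, i ≠ j → ∀ u ∈ U i, ∀ w ∈ U j, ∀ A ∈ toForms 𝒜, A u w = 0 := by
      rintro i j hij u hu w hw _ ⟨A, hA, rfl⟩
      simpa [Matrix.toBilin'_apply'] using horth i j hij u hu w hw A hA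
    obtain ⟨e, he, he1, he0⟩ := exists_isSplit_of_finrank_eq hU horth'
      (by rw [hfr, hdim]; exact Finset.sum_congr rfl fun i _ => finrank_restriction 𝒜 (U i))
      ⟨0, by omega⟩
    refine ⟨e, he, fun h => ?_, fun h => ?_⟩
    · refine hne ⟨0, by omega⟩ ((Submodule.eq_bot_iff _).2 fun x hx => ?_)
      rw [← he1 x hx, h, LinearMap.zero_apply]
    · refine hne ⟨1, by omega⟩ ((Submodule.eq_bot_iff _).2 fun x hx => ?_)
      rw [← he0 ⟨1, by omega⟩ (by simp) x hx, h, End.one_apply]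
  · rintro ⟨e, he, h0, h1⟩
    refine ⟨2, le_rfl, splitSummands e, ⟨isInternal_splitSummands he.idem, fun i => ?_,
      fun i j hij u hu w hw A hA => ?_⟩, ?_⟩
    · fin_cases i
      · exact fun h => h0 (LinearMap.range_eq_bot.1 h)
      · intro h
        refine h1 (LinearMap.ext fun x => LinearMap.ker_eq_bot.1 h ?_)
        exact LinearMap.congr_fun he.idem x
    · have := he.orthogonal i j hij u hu w hw _ ⟨A, hA, rfl⟩
      simpa [Matrix.toBilin'_apply'] using this
    · rw [← hfr, he.finrank_eq]
      exact Finset.sum_congr rfl fun i _ => (finrank_restriction 𝒜 _).symm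

/-- The correspondence between spaces of matrices and spaces of forms. -/
noncomputable def toFormsEquiv :
    Submodule F (Matrix (Fin n) (Fin n) F) ≃ Submodule F (BilinForm F (Fin n → F)) :=
  (Submodule.orderIsoMapComap (Matrix.toBilin' : Matrix (Fin n) (Fin n) F ≃ₗ[F] _)).toEquiv

theorem toFormsEquiv_apply (𝒜 : Submodule F (Matrix (Fin n) (Fin n) F)) :
    toFormsEquiv 𝒜 = toForms 𝒜 := rfl

theorem NDS_eq_ndsCard (m : ℕ+) : NDS F m = ndsCard F (Fin m → F) :=
  Nat.card_congr (toFormsEquiv.subtypeEquiv fun 𝒜 => (isNDForms_toForms_iff 𝒜).symm)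

theorem DIS_eq_disCard (m : ℕ+) : DIS F m = disCard F (Fin m → F) := by
  refine Nat.card_congr (toFormsEquiv.subtypeEquiv fun 𝒜 => ?_)
  rw [toFormsEquiv_apply, ← and_assoc, ← isNDForms_toForms_iff, isDirectlyDecomposable_iff]
  have : NeZero (m : ℕ) := ⟨m.ne_zero⟩
  refine and_congr_right fun _ => ⟨fun h => ⟨IsSplit.one, one_ne_zero, fun f hf _ => ?_⟩,
    fun h => ?_⟩
  · by_contra! hf'
    exact h ⟨f, hf, hf'⟩
  · rintro ⟨e, he, h0, h1⟩
    exact (h.minimal e he (mul_one e)).elim h0 h1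

end Bridge

/-! ### The generating functions -/

section Series

open PowerSeries

/-- A formal power series is determined by its constant coefficient and a linear differential
equation of the first order. -/
theorem eq_of_derivative_eq_mul {h y z : PowerSeries ℚ} (hy : d⁄dX ℚ y = h * y)
    (hz : d⁄dX ℚ z = h * z) (h0 : constantCoeff y = constantCoeff z) : y = z := by
  ext n
  induction n using Nat.strong_induction_on with
  | _ n ih =>
    cases n with
    | zero => simpa using h0
    | succ n =>
      have h1 : coeff n (d⁄dX ℚ y) = coeff n (d⁄dX ℚ z) := by
        rw [hy, hz, coeff_mul, coeff_mul]
        refine Finset.sum_congr rfl fun p hp => ?_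
        rw [ih p.2 (by have := Finset.HasAntidiagonal.mem_antidiagonal.1 hp; omega)]
      rw [coeff_derivative, coeff_derivative] at h1
      exact mul_right_cancel₀ (by positivity) h1

theorem coeff_expq_succ (q : ℕ) (f : ℕ+ → ℕ) (n : ℕ) :
    coeff (n + 1) (expq q f) =
      (f n.succPNat : ℚ) / (q ^ (n + 1).choose 2 * qFactorial q (n + 1)) := by
  rw [expq, coeff_mk, dif_pos n.succ_pos]
  rfl

theorem constantCoeff_expq (q : ℕ) (f : ℕ+ → ℕ) : constantCoeff (expq q f) = 0 := by
  rw [← coeff_zero_eq_constantCoeff_apply, expq, coeff_mk, dif_neg (lt_irrefl 0)]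

variable (F : Type*) [Field F] [Fintype F]

theorem coeff_one_add_expq_NDS (n : ℕ) :
    coeff n (1 + expq (Fintype.card F) (NDS F)) = (ndsCard F (Fin n → F) : ℚ) /
      (Fintype.card F ^ n.choose 2 * qFactorial (Fintype.card F) n) := by
  cases n with
  | zero => simp [constantCoeff_expq, ndsCard_zero, qFactorial]
  | succ n =>
    rw [map_add, coeff_expq_succ, NDS_eq_ndsCard, coeff_one, if_neg n.succ_ne_zero, zero_add]
    rfl

theorem coeff_expq_DIS (n : ℕ) :
    coeff n (expq (Fintype.card F) (DIS F)) = (disCard F (Fin n → F) : ℚ) /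
      (Fintype.card F ^ n.choose 2 * qFactorial (Fintype.card F) n) := by
  cases n with
  | zero => simp [constantCoeff_expq, disCard_zero]
  | succ n =>
    rw [coeff_expq_succ, DIS_eq_disCard]
    rfl

/-- The recurrence for the number of non-degenerate spaces, as a differential equation. -/
theorem derivative_one_add_expq_NDS :
    d⁄dX ℚ (1 + expq (Fintype.card F) (NDS F)) =
      d⁄dX ℚ (expq (Fintype.card F) (DIS F)) * (1 + expq (Fintype.card F) (NDS F)) := by
  have hq : 1 < Fintype.card F := Fintype.one_lt_card
  set q := Fintype.card F with hqdef
  let w (n : ℕ) : ℚ := q ^ n.choose 2 * qFactorial q n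
  have hw (n : ℕ) : w n ≠ 0 := by
    have : 0 < qFactorial q n := Finset.prod_pos fun i _ =>
      Finset.sum_pos (fun j _ => by positivity) ⟨0, by simp⟩
    have : 0 < w n := by positivity
    exact this.ne'
  have hgl (n : ℕ) : (glCard F n : ℚ) = w n * (q - 1) ^ n := by
    rw [glCard_eq, ← hqdef]
    push_cast [Nat.cast_sub hq.le]
    rfl
  have hq1 : (q : ℚ) - 1 ≠ 0 := by
    have : (1 : ℚ) < q := by exact_mod_cast hq
    exact (sub_pos.2 this).ne'
  -- The powers of `q - 1` in the orders of the general linear groups cancel.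
  have hidem (k m : ℕ) : (idemCard F (Fin (k + m) → F) k : ℚ) * (w k * w m) = w (k + m) := by
    have h := congrArg (Nat.cast (R := ℚ)) (idemCard_mul (F := F) (V := Fin (k + m) → F)
      (k := k) (m := m) (by simp))
    push_cast at h
    rw [hgl, hgl, hgl, pow_add] at h
    have hpk := pow_ne_zero k hq1
    have hpm := pow_ne_zero m hq1
    refine mul_right_cancel₀ (mul_ne_zero hpk hpm) ?_
    linear_combination h
  ext n
  have hrec := congrArg (Nat.cast (R := ℚ)) (finrank_mul_ndsCard (F := F) (V := Fin (n + 1) → F))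
  rw [finrank_fin_fun, Finset.sum_range_succ', zero_mul, add_zero] at hrec
  push_cast at hrec
  rw [coeff_derivative, coeff_mul, coeff_one_add_expq_NDS,
    Finset.Nat.sum_antidiagonal_eq_sum_range_succ_mk]
  change _ / w (n + 1) * _ = _
  rw [div_mul_eq_mul_div, div_eq_iff (hw _), mul_comm, hrec, Finset.sum_mul]
  refine Finset.sum_congr rfl fun k hk => ?_
  obtain ⟨m, rfl⟩ := Nat.exists_eq_add_of_le (Finset.mem_range_succ_iff.1 hk)
  rw [coeff_derivative, coeff_expq_DIS, coeff_one_add_expq_NDS, Nat.add_sub_cancel_left,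
    show k + m + 1 = k + 1 + m by ring, Nat.add_sub_cancel_left, ← hidem (k + 1) m]
  change _ = _ / w (k + 1) * _ * (_ / w m) * _
  have h1 := hw (k + 1)
  have h2 := hw m
  field_simp

theorem constantCoeff_exp_subst {g : PowerSeries ℚ} (hg : constantCoeff g = 0) :
    constantCoeff ((exp ℚ).subst g) = 1 := by
  have h : (exp ℚ).subst g = (exp ℚ - 1).subst g + 1 := by
    have hs := HasSubst.of_constantCoeff_zero' hg
    have h1 : (1 : PowerSeries ℚ).subst g = (1 : PowerSeries ℚ) := by
      rw [← coe_substAlgHom hs, map_one]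
    conv_lhs => rw [← sub_add_cancel (exp ℚ) 1, subst_add hs, h1]
  rw [h, map_add, map_one]
  have h0 : constantCoeff ((exp ℚ - 1).subst g) = 0 :=
    constantCoeff_subst_eq_zero hg (exp ℚ - 1) (by simp)
  rw [h0, zero_add]

end Series

end AltSpace

theorem mainTheorem1 (F : Type*) [Field F] [Fintype F] :
    1 + AltSpace.expq (Fintype.card F) (AltSpace.NDS F) =
      (PowerSeries.exp ℚ).subst (AltSpace.expq (Fintype.card F) (AltSpace.DIS F)) := by
  have hs := AltSpace.hasSubst_expq (Fintype.card F) (AltSpace.DIS F)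
  refine AltSpace.eq_of_derivative_eq_mul (AltSpace.derivative_one_add_expq_NDS F) ?_ ?_
  · rw [PowerSeries.derivative_subst hs, PowerSeries.derivative_exp, mul_comm]
  · rw [AltSpace.constantCoeff_exp_subst (AltSpace.constantCoeff_expq _ _), map_add, map_one,
      AltSpace.constantCoeff_expq, add_zero]
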